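/- Let $F(x)=\prod_{m=1}^{\infty}\frac{1}{1-x^m}$ for complex $x$ with $|x|<1$. Let $h$ and $k$ be integers with $1\le h\le k$ and $\gcd(h,k)=1$, and let $H$ be an integer with $hH\equiv -1 \pmod k$. Let $s(h,k)$ denote the Dedekind sum $$s(h,k)=\sum_{r=1}^{k-1}\frac{r}{k}\left(\frac{hr}{k}-\left\lfloor\frac{hr}{k}\right\rfloor-\frac12\right),$$ which is $0$ (an empty sum) for $k=1$. Let $z$ be a complex number with $\operatorname{Re} z>0$, and put $$w=\exp\left(\frac{2\pi i h}{k}-\frac{2\pi z}{k^2}\right),\qquad w'=\exp\left(\frac{2\pi i H}{k}-\frac{2\pi}{z}\right).$$ Then $|w|<1$ and $|w'|<1$, the infinite products defining $F(w)$ and $F(w')$ converge, and $$F(w)=e^{\pi i s(h,k)}\left(\frac{z}{k}\right)^{1/2}\exp\left(\frac{\pi}{12z}-\frac{\pi z}{12k^2}\right)F(w'),$$ where $(z/k)^{1/2}$ is the principal value of the square root. -/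

import Mathlib

/-- The generating function `F(x) = ∏_{m ≥ 1} 1 / (1 - x ^ m)` of the partition function, where the
factor of index `n : ℕ` is the one with `m = n + 1`. The product converges for `‖x‖ < 1`. -/
noncomputable def partitionGenFun (x : ℂ) : ℂ :=
  ∏' n : ℕ, 1 / (1 - x ^ (n + 1))

/-- The Dedekind sum `s(h, k) = ∑_{r=1}^{k-1} (r / k) (h r / k - ⌊h r / k⌋ - 1 / 2)`; for `k = 1` the
sum is empty, so that `s(h, 1) = 0`. -/
noncomputable def dedekindSum (h : ℤ) (k : ℕ) : ℝ :=
  ∑ r ∈ Finset.Ico 1 k,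
    ((r : ℝ) / (k : ℝ)) *
      ((h : ℝ) * (r : ℝ) / (k : ℝ) - (⌊(h : ℝ) * (r : ℝ) / (k : ℝ)⌋ : ℝ) - 1 / 2)

/-!
For `q = exp (2 * π * I * τ)` the generating function is `F q = q ^ (1 / 24) / η τ`
(`hasProd_partitionGenFun`), so the claim is the transformation law of Dedekind's `η` between
`τ = (h + I * u) / k` and `τ' = (H + I / u) / k`, where `u = z / k`:

`η τ' = exp (π * I * (s(h, k) + (H - h) / (12 * k))) * sqrt u * η τ` (`eta_transformation`).

The law is proved by Euclid's algorithm on `(h, k)`. Replacing `h` by its residue modulo `k`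
translates `τ` by an integer, which multiplies `η` by a root of unity (`eta_add_intCast`) and leaves
the Dedekind sum unchanged (`dedekindSum_add_mul`). If `0 < h < k`, then `-1 / τ = (-k + I * v) / h`
with `v = u / τ` of positive real part, and the point paired with it in the law for the
pair `(-k, h)` is again `τ'`. The law for the smaller denominator `h` and the inversion
`η (-1 / τ) = (sqrt I)⁻¹ * sqrt τ * η τ` give the law for `k`, once the multipliers are compared
(`eta_transformation_step`): the square roots match because `τ` is a quotient of two
numbers with positive real part, and the roots of unity match by the reciprocity law for
Dedekind sums (`dedekindSum_reciprocity`). The algorithm ends at `k = 1`, where the law is the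
inversion formula in the variable `τ = I * u`, followed by a translation (`eta_I_div`).

Reciprocity follows from expanding `∑ (h * r % k) ^ 2`, which is `∑ r ^ 2` because multiplication by
`h` permutes the residues, and from counting weighted lattice points in a triangle by columns and by
rows (`sum_mul_div_mul_succ`).
-/

/-! ### Dedekind sums and their reciprocity law -/

lemma dedekindSum_eq_sum_fract (h : ℤ) (k : ℕ) :
    dedekindSum h k = ∑ r ∈ Finset.Ico 1 k,
      ((r : ℝ) / (k : ℝ)) * (Int.fract ((h : ℝ) * (r : ℝ) / (k : ℝ)) - 1 / 2) := rfl

lemma dedekindSum_add_mul (h n : ℤ) (k : ℕ) : dedekindSum (h + n * k) k = dedekindSum h k := by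
  rw [dedekindSum_eq_sum_fract, dedekindSum_eq_sum_fract]
  refine Finset.sum_congr rfl fun r hr ↦ ?_
  have hk : (k : ℝ) ≠ 0 := by
    have := Finset.mem_Ico.mp hr
    exact_mod_cast (by omega : k ≠ 0)
  have : ((h + n * k : ℤ) : ℝ) * r / k = (h : ℝ) * r / k + ((n * r : ℤ) : ℝ) := by
    push_cast
    field_simp
  rw [this, Int.fract_add_intCast]

lemma dedekindSum_neg {h : ℤ} {k : ℕ} (hcop : IsCoprime h (k : ℤ)) :
    dedekindSum (-h) k = -dedekindSum h k := by
  rw [dedekindSum_eq_sum_fract, dedekindSum_eq_sum_fract, ← Finset.sum_neg_distrib]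
  refine Finset.sum_congr rfl fun r hr ↦ ?_
  obtain ⟨hr1, hrk⟩ := Finset.mem_Ico.mp hr
  have hk : (k : ℝ) ≠ 0 := by exact_mod_cast (by omega : k ≠ 0)
  have hne : Int.fract ((h : ℝ) * r / k) ≠ 0 := by
    rw [Ne, Int.fract_eq_zero_iff]
    rintro ⟨m, hm⟩
    rw [eq_div_iff hk] at hm
    have hm' : m * k = h * r := by exact_mod_cast hm
    have hdvd : (k : ℤ) ∣ r := hcop.symm.dvd_of_dvd_mul_left ⟨m, by rw [← hm', mul_comm]⟩
    have := Nat.le_of_dvd hr1 (Int.natCast_dvd_natCast.mp hdvd)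
    omega
  have : ((-h : ℤ) : ℝ) * r / k = -((h : ℝ) * r / k) := by
    push_cast
    ring
  rw [this, Int.fract_neg hne]
  ring

lemma dedekindSum_natCast (h k : ℕ) :
    dedekindSum h k = ∑ r ∈ Finset.range k,
      ((r : ℝ) / k) * ((h : ℝ) * r / k - ((h * r / k : ℕ) : ℝ) - 1 / 2) := by
  rcases k.eq_zero_or_pos with rfl | hk
  · simp [dedekindSum]
  rw [dedekindSum, Finset.range_eq_Ico, Finset.sum_eq_sum_Ico_succ_bot hk]
  simp only [Nat.cast_zero, zero_div, zero_mul, zero_add]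
  refine Finset.sum_congr rfl fun r _ ↦ ?_
  have : ⌊((h : ℤ) : ℝ) * r / k⌋ = ((h * r / k : ℕ) : ℤ) := by
    rw [← Nat.floor_div_eq_div (K := ℝ), Int.natCast_floor_eq_floor (by positivity)]
    push_cast
    rfl
  rw [this]
  push_cast
  rfl

/-- Multiplication by a unit permutes the residues modulo `k`. -/
lemma sum_range_mul_mod {M : Type*} [AddCommMonoid M] {h k : ℕ} (hcop : h.Coprime k) (g : ℕ → M) :
    ∑ r ∈ Finset.range k, g (h * r % k) = ∑ r ∈ Finset.range k, g r := by
  have hmaps : Set.MapsTo (fun r ↦ h * r % k) (Finset.range k) (Finset.range k) := by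
    intro r hr
    have hr' : r < k := by simpa using hr
    simpa using Nat.mod_lt _ (by omega : 0 < k)
  have hinj : Set.InjOn (fun r ↦ h * r % k) (Finset.range k) := by
    intro a ha b hb hab
    have : a ≡ b [MOD k] := Nat.ModEq.cancel_left_of_coprime hcop.symm hab
    exact this.eq_of_lt_of_lt (by simpa using ha) (by simpa using hb)
  exact Finset.sum_nbij _ hmaps hinj
    (Finset.surjOn_of_injOn_of_card_le _ hmaps hinj le_rfl) fun _ _ ↦ rfl

/-- For `0 < v < h` the multiples `h * r`, `r < k`, that are at least `k * v` are those with
`r > ⌊k * v / h⌋`, because `h * r = k * v` is impossible. -/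
lemma card_filter_le_mul_div {h k v : ℕ} (hcop : h.Coprime k) (hv : 0 < v) (hvh : v < h) :
    ((Finset.range k).filter fun r ↦ v ≤ h * r / k).card + k * v / h + 1 = k := by
  rcases k.eq_zero_or_pos with rfl | hk
  · simp_all
  have hlt : k * v / h < k := by
    rw [Nat.div_lt_iff_lt_mul (by omega)]
    exact Nat.mul_lt_mul_of_pos_left hvh hk
  have : (Finset.range k).filter (fun r ↦ v ≤ h * r / k) = Finset.Ico (k * v / h + 1) k := by
    ext r
    simp only [Finset.mem_filter, Finset.mem_range, Finset.mem_Ico, Nat.succ_le_iff,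
      Nat.le_div_iff_mul_le hk, Nat.div_lt_iff_lt_mul (by omega : 0 < h)]
    have hne : k * v ≠ h * r := fun he ↦ by
      have := Nat.le_of_dvd hv (hcop.dvd_of_dvd_mul_left ⟨r, he⟩)
      omega
    rw [mul_comm v k, mul_comm r h]
    omega
  rw [this, Nat.card_Ico]
  omega

/-- Counting lattice points below the line of slope `h / k`, weighted by their height, by columns
and by rows. -/
lemma sum_mul_div_mul_succ {h k : ℕ} (hcop : h.Coprime k) :
    ∑ r ∈ Finset.range k, ((h * r / k : ℕ) : ℝ) * ((h * r / k : ℕ) + 1) =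
      ∑ v ∈ Finset.range h, 2 * (v : ℝ) * (k - 1 - (k * v / h : ℕ)) := by
  have hcol : ∀ r ∈ Finset.range k, ((h * r / k : ℕ) : ℝ) * ((h * r / k : ℕ) + 1) =
      ∑ v ∈ Finset.range h, if v ≤ h * r / k then 2 * (v : ℝ) else 0 := by
    intro r hr
    have hr' : r < k := by simpa using hr
    rcases h.eq_zero_or_pos with rfl | hh
    · simp
    have hlt : h * r / k < h := by
      rw [Nat.div_lt_iff_lt_mul (by omega)]
      exact Nat.mul_lt_mul_of_pos_left hr' hh
    rw [← Finset.sum_filter]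
    have : (Finset.range h).filter (fun v ↦ v ≤ h * r / k) = Finset.range (h * r / k + 1) := by
      ext v
      simp only [Finset.mem_filter, Finset.mem_range]
      omega
    rw [this, ← Finset.mul_sum, ← Nat.cast_sum, mul_comm (2 : ℝ)]
    have := Finset.sum_range_id_mul_two (h * r / k + 1)
    rw [Nat.add_sub_cancel, mul_comm (_ + 1)] at this
    exact_mod_cast this.symm
  rw [Finset.sum_congr rfl hcol, Finset.sum_comm]
  refine Finset.sum_congr rfl fun v hv ↦ ?_
  rcases v.eq_zero_or_pos with rfl | hv0
  · simp
  rw [← Finset.sum_filter, Finset.sum_const, nsmul_eq_mul, mul_comm]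
  congr 1
  have := card_filter_le_mul_div hcop hv0 (by simpa using hv)
  rw [eq_sub_iff_add_eq, eq_sub_iff_add_eq]
  exact_mod_cast this

lemma sum_range_cast (k : ℕ) : ∑ r ∈ Finset.range k, (r : ℝ) = k * (k - 1) / 2 := by
  induction k with
  | zero => simp
  | succ n ih => rw [Finset.sum_range_succ, ih]; push_cast; ring

lemma sum_range_cast_sq (k : ℕ) :
    ∑ r ∈ Finset.range k, (r : ℝ) ^ 2 = k * (k - 1) * (2 * k - 1) / 6 := by
  induction k with
  | zero => simp
  | succ n ih => rw [Finset.sum_range_succ, ih]; push_cast; ring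

lemma dedekindSum_natCast_eq {h k : ℕ} (hk : 0 < k) :
    dedekindSum h k = h * (k - 1) * (2 * k - 1) / (6 * k) - (k - 1) / 4
      - (∑ r ∈ Finset.range k, (r : ℝ) * (h * r / k : ℕ)) / k := by
  have hk' : (k : ℝ) ≠ 0 := by exact_mod_cast hk.ne'
  have hterm : ∀ r ∈ Finset.range k,
      ((r : ℝ) / k) * ((h : ℝ) * r / k - ((h * r / k : ℕ) : ℝ) - 1 / 2) =
        h / k ^ 2 * (r : ℝ) ^ 2 - (r : ℝ) * (h * r / k : ℕ) / k - 1 / (2 * k) * r := by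
    intro r _
    field_simp
  rw [dedekindSum_natCast, Finset.sum_congr rfl hterm, Finset.sum_sub_distrib,
    Finset.sum_sub_distrib, ← Finset.mul_sum, ← Finset.mul_sum, ← Finset.sum_div, sum_range_cast,
    sum_range_cast_sq]
  field_simp
  ring

/-- Dedekind's reciprocity law. -/
theorem dedekindSum_reciprocity {h k : ℕ} (hh : 0 < h) (hk : 0 < k) (hcop : h.Coprime k) :
    dedekindSum h k + dedekindSum k h =
      -1 / 4 + ((h : ℝ) / k + (k : ℝ) / h + 1 / (h * k)) / 12 := by
  have hh' : (h : ℝ) ≠ 0 := by exact_mod_cast hh.ne'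
  have hk' : (k : ℝ) ≠ 0 := by exact_mod_cast hk.ne'
  have hmod (r : ℕ) : ((h * r % k : ℕ) : ℝ) = h * r - k * (h * r / k : ℕ) := by
    rw [eq_sub_iff_add_eq]
    exact_mod_cast Nat.mod_add_div (h * r) k
  have h1 := sum_range_mul_mod hcop (fun r ↦ (r : ℝ))
  have h2 := sum_range_mul_mod hcop (fun r ↦ (r : ℝ) ^ 2)
  have h3 := sum_mul_div_mul_succ hcop
  have e1 : ∑ r ∈ Finset.range k, ((h * r % k : ℕ) : ℝ) =
      h * ∑ r ∈ Finset.range k, (r : ℝ) - k * ∑ r ∈ Finset.range k, ((h * r / k : ℕ) : ℝ) := by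
    simp only [hmod, Finset.sum_sub_distrib, Finset.mul_sum]
  have e2 : ∑ r ∈ Finset.range k, ((h * r % k : ℕ) : ℝ) ^ 2 =
      h ^ 2 * ∑ r ∈ Finset.range k, (r : ℝ) ^ 2
        - 2 * h * k * ∑ r ∈ Finset.range k, (r : ℝ) * (h * r / k : ℕ)
        + k ^ 2 * ∑ r ∈ Finset.range k, ((h * r / k : ℕ) : ℝ) ^ 2 := by
    simp only [hmod, Finset.mul_sum, ← Finset.sum_sub_distrib, ← Finset.sum_add_distrib]
    exact Finset.sum_congr rfl fun r _ ↦ by ring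
  have e3 : ∑ r ∈ Finset.range k, ((h * r / k : ℕ) : ℝ) * ((h * r / k : ℕ) + 1) =
      ∑ r ∈ Finset.range k, ((h * r / k : ℕ) : ℝ) ^ 2
        + ∑ r ∈ Finset.range k, ((h * r / k : ℕ) : ℝ) := by
    rw [← Finset.sum_add_distrib]
    exact Finset.sum_congr rfl fun r _ ↦ by ring
  have e4 : ∑ v ∈ Finset.range h, 2 * (v : ℝ) * (k - 1 - (k * v / h : ℕ)) =
      2 * (k - 1) * ∑ v ∈ Finset.range h, (v : ℝ)
        - 2 * ∑ v ∈ Finset.range h, (v : ℝ) * (k * v / h : ℕ) := by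
    simp only [Finset.mul_sum, ← Finset.sum_sub_distrib]
    exact Finset.sum_congr rfl fun r _ ↦ by ring
  rw [e1] at h1
  rw [e2] at h2
  rw [e3, e4] at h3
  rw [sum_range_cast] at h1 h3
  rw [sum_range_cast_sq] at h2
  rw [dedekindSum_natCast_eq hk, dedekindSum_natCast_eq hh]
  generalize ∑ r ∈ Finset.range k, ((h * r / k : ℕ) : ℝ) = B at *
  generalize ∑ r ∈ Finset.range k, ((h * r / k : ℕ) : ℝ) ^ 2 = A at *
  generalize ∑ r ∈ Finset.range k, (r : ℝ) * (h * r / k : ℕ) = Q at *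
  generalize ∑ v ∈ Finset.range h, (v : ℝ) * (k * v / h : ℕ) = Q' at *
  have hB : B = (h - 1) * (k - 1) / 2 := by
    field_simp at h1 ⊢
    linarith
  have hA : A = 2 * (k - 1) * (h * (h - 1) / 2) - 2 * Q' - B := by linarith
  have hQ : Q = (h ^ 2 * (k * (k - 1) * (2 * k - 1) / 6) + k ^ 2 * A
      - k * (k - 1) * (2 * k - 1) / 6) / (2 * h * k) := by
    rw [eq_div_iff (by positivity)]
    linarith
  rw [hQ, hA, hB]
  field_simp
  ring

open Complex hiding eta

open ModularForm

open scoped Real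

/-! ### Translation, inversion and principal square roots -/

lemma eta_add_intCast (τ : ℂ) (n : ℤ) : eta (τ + n) = cexp (π * I * n / 12) * eta τ := by
  have h1 (m : ℕ) : eta_q m (τ + n) = eta_q m τ := by
    rw [eta_q_eq_pow, eta_q_eq_pow, mul_add, exp_add, mul_comm (2 * π * I) (n : ℂ),
      exp_int_mul_two_pi_mul_I, mul_one]
  have h2 : Function.Periodic.qParam 24 (τ + n) =
      cexp (π * I * n / 12) * Function.Periodic.qParam 24 τ := by
    rw [Function.Periodic.qParam, Function.Periodic.qParam, ← exp_add]
    congr 1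
    push_cast
    ring
  simp only [eta, h1, h2, mul_assoc]

lemma sqrt_mul_of_arg_add_mem {x y : ℂ} (hx : x ≠ 0) (hy : y ≠ 0)
    (h : x.arg + y.arg ∈ Set.Ioc (-π) π) : sqrt (x * y) = sqrt x * sqrt y := by
  rw [sqrt_eq_exp (mul_ne_zero hx hy), sqrt_eq_exp hx, sqrt_eq_exp hy, ← exp_add,
    log_mul hx hy h]
  ring_nf

lemma abs_arg_lt_of_re_pos {x : ℂ} (hx : 0 < x.re) : -(π / 2) < x.arg ∧ x.arg < π / 2 :=
  abs_lt.mp (abs_arg_lt_pi_div_two_iff.mpr (Or.inl hx))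

lemma re_inv_pos {x : ℂ} (hx : 0 < x.re) : 0 < (x⁻¹).re := by
  rw [inv_re]
  exact div_pos hx (normSq_pos.mpr (ne_zero_of_re_pos hx))

lemma sqrt_mul_of_re_pos {x y : ℂ} (hx : 0 < x.re) (hy : 0 < y.re) :
    sqrt (x * y) = sqrt x * sqrt y := by
  have h1 := abs_arg_lt_of_re_pos hx
  have h2 := abs_arg_lt_of_re_pos hy
  exact sqrt_mul_of_arg_add_mem (ne_zero_of_re_pos hx) (ne_zero_of_re_pos hy)
    ⟨by linarith, by linarith⟩

lemma sqrt_I_mul_of_re_pos {x : ℂ} (hx : 0 < x.re) : sqrt (I * x) = sqrt I * sqrt x := by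
  have h1 := abs_arg_lt_of_re_pos hx
  refine sqrt_mul_of_arg_add_mem I_ne_zero (ne_zero_of_re_pos hx) ⟨?_, ?_⟩ <;>
  · rw [arg_I]
    linarith

lemma sqrt_I_eq_exp : sqrt I = cexp (π * I / 4) := by
  rw [sqrt_eq_exp I_ne_zero, log_I]
  ring_nf

lemma eta_neg_one_div {τ : ℂ} (hτ : 0 < τ.im) :
    eta (-1 / τ) = (sqrt I)⁻¹ * sqrt τ * eta τ := by
  simpa [mul_assoc] using eta_comp_eq_csqrt_I_inv (x := τ) hτ

lemma im_add_I_mul_div_pos (h : ℤ) {k : ℕ} (hk : 0 < k) {u : ℂ} (hu : 0 < u.re) :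
    0 < ((h + I * u) / k).im := by
  have hk' : (0 : ℝ) < k := by exact_mod_cast hk
  rw [← ofReal_natCast, div_ofReal_im]
  simpa using div_pos hu hk'

/-- Inversion of `η` in the variable `τ = I * u`, in which the factor `(sqrt I)⁻¹` cancels. -/
lemma eta_I_div {u : ℂ} (hu : 0 < u.re) : eta (I / u) = sqrt u * eta (I * u) := by
  have hu0 := ne_zero_of_re_pos hu
  have hI : sqrt I ≠ 0 := by rw [sqrt_I_eq_exp]; exact exp_ne_zero _
  have h1 : I / u = -1 / (I * u) := by
    field_simp
    rw [I_sq]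
  rw [h1, eta_neg_one_div (by simpa using hu), sqrt_I_mul_of_re_pos hu]
  field_simp

/-! ### The transformation law of `η` -/

/-- If the law holds for `-k` with denominator `a`, then it holds for `a` with denominator `k`. For
`τ = (a + I * u) / k` one has `-1 / τ = (-k + I * v) / a` with `v = u / τ`, and Dedekind's
reciprocity law matches the multipliers. -/
lemma eta_transformation_step {a k : ℕ} (ha : 0 < a) (hk : 0 < k) {H K : ℤ}
    (hK : k * K = a * H + 1) {u : ℂ} (hu : 0 < u.re)
    (ih : ∀ v : ℂ, 0 < v.re → eta ((K + I / v) / a) =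
      cexp (π * I * (dedekindSum (-k) a + (K - (-k : ℤ)) / (12 * a))) * sqrt v *
        eta (((-k : ℤ) + I * v) / a)) :
    eta ((H + I / u) / k) =
      cexp (π * I * (dedekindSum a k + (H - a) / (12 * k))) * sqrt u *
        eta ((a + I * u) / k) := by
  have hu0 := ne_zero_of_re_pos hu
  have ha0 : (a : ℂ) ≠ 0 := by exact_mod_cast ha.ne'
  have hk0 : (k : ℂ) ≠ 0 := by exact_mod_cast hk.ne'
  have hcop : IsCoprime (k : ℤ) (a : ℤ) := ⟨K, -H, by linear_combination hK⟩
  have hKc : (k : ℂ) * K = a * H + 1 := by exact_mod_cast hK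
  set τ : ℂ := (a + I * u) / k with hτ
  have hτim : 0 < τ.im := by
    simpa only [Int.cast_natCast] using im_add_I_mul_div_pos a hk hu
  have hτ0 : τ ≠ 0 := fun h ↦ by simp [h] at hτim
  have hnum : (a : ℂ) + I * u ≠ 0 := fun h ↦ hτ0 (by rw [hτ, h, zero_div])
  obtain ⟨v, hv⟩ : ∃ v, v = u / τ := ⟨_, rfl⟩
  have hvinv : v⁻¹ = (a * u⁻¹ + I) / k := by
    rw [hv, hτ]
    field_simp
  have hvre : 0 < v.re := by
    have hre : (v⁻¹).re = a * (u⁻¹).re / k := by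
      rw [hvinv, ← ofReal_natCast k, div_ofReal_re]
      simp [-inv_re]
    have := re_inv_pos (x := v⁻¹) (by
      rw [hre]
      have := re_inv_pos hu
      positivity)
    rwa [inv_inv] at this
  have hv0 := ne_zero_of_re_pos hvre
  have harg1 : (K + I / v) / a = (H + I / u) / k := by
    rw [div_eq_mul_inv I v, hvinv]
    field_simp
    linear_combination hKc * u + u * I_sq
  have harg2 : ((-k : ℤ) + I * v) / a = -1 / τ := by
    rw [hv, hτ]
    push_cast
    field_simp
    ring
  -- `τ` is the quotient of two numbers of positive real part, so principal roots divide.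
  have hsqrt : sqrt v * sqrt τ = sqrt u := by
    have h1 : τ = u * v⁻¹ := by rw [hv]; field_simp
    have h2 : sqrt v * sqrt v⁻¹ = 1 := by
      rw [← sqrt_mul_of_re_pos hvre (re_inv_pos hvre), mul_inv_cancel₀ hv0]
      simp
    rw [h1, sqrt_mul_of_re_pos hu (re_inv_pos hvre)]
    linear_combination sqrt u * h2
  have hrec : (dedekindSum a k : ℂ) + dedekindSum k a =
      -1 / 4 + ((a : ℂ) / k + k / a + 1 / (a * k)) / 12 := by
    have := congrArg ((↑) : ℝ → ℂ)
      (dedekindSum_reciprocity ha hk (Nat.isCoprime_iff_coprime.mp hcop).symm)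
    push_cast at this
    exact this
  have hexp : cexp (π * I * (dedekindSum (-k) a + (K - (-k : ℤ)) / (12 * a))) * (sqrt I)⁻¹ =
      cexp (π * I * (dedekindSum a k + (H - a) / (12 * k))) := by
    rw [sqrt_I_eq_exp, ← exp_neg, ← exp_add]
    congr 1
    have hKdiv : (K : ℂ) = (a * H + 1) / k := by rw [← hKc]; field_simp
    rw [dedekindSum_neg hcop, eq_sub_of_add_eq hrec, hKdiv]
    push_cast
    field_simp
    ring
  rw [← harg1, ih v hvre, harg2, eta_neg_one_div hτim, ← hexp, ← hsqrt]
  ring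

/-- Dedekind's transformation law for `η`, with the two arguments in the symmetric form
`(h + i u) / k` and `(H + i / u) / k`, where `h * H ≡ -1` modulo `k`. -/
theorem eta_transformation {k : ℕ} (hk : 0 < k) (h H : ℤ) (hH : (k : ℤ) ∣ h * H + 1) {u : ℂ}
    (hu : 0 < u.re) :
    eta ((H + I / u) / k) =
      cexp (π * I * (dedekindSum h k + (H - h) / (12 * k))) * sqrt u *
        eta ((h + I * u) / k) := by
  induction k using Nat.strong_induction_on generalizing h H u with
  | _ k ih =>
    have hk0 : (k : ℂ) ≠ 0 := by exact_mod_cast hk.ne'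
    have hkZ : (k : ℤ) ≠ 0 := by exact_mod_cast hk.ne'
    obtain ⟨a, ha⟩ := Int.eq_ofNat_of_zero_le (Int.emod_nonneg h hkZ)
    obtain ⟨n, hn⟩ : ∃ n : ℤ, h = a + n * k := ⟨h / k, by
      rw [← ha, mul_comm, Int.emod_add_mul_ediv]⟩
    have hak : a < k := by
      have := Int.emod_lt_of_pos h (by exact_mod_cast hk : (0 : ℤ) < k)
      rw [ha] at this
      exact_mod_cast this
    have haH : (k : ℤ) ∣ a * H + 1 := by
      have : (a : ℤ) * H + 1 = (h * H + 1) - k * (n * H) := by rw [hn]; ring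
      rw [this]
      exact hH.sub (dvd_mul_right _ _)
    have hred : eta ((H + I / u) / k) =
        cexp (π * I * (dedekindSum a k + (H - a) / (12 * k))) * sqrt u *
          eta ((a + I * u) / k) := by
      rcases a.eq_zero_or_pos with rfl | ha0
      · have hk1 : k = 1 := by
          have : (k : ℤ) ∣ 1 := by simpa using haH
          exact_mod_cast Int.eq_one_of_dvd_one (by positivity) this
        subst hk1
        -- Here `h` is `0` modulo `1`; only the inversion and a translation by `H` remain.
        have h1 : ((H : ℂ) + I / u) / (1 : ℕ) = I / u + H := by simp [add_comm]
        rw [h1, eta_add_intCast, eta_I_div hu]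
        simp [dedekindSum, mul_assoc, mul_div_assoc]
      · obtain ⟨K, hK⟩ := haH
        refine eta_transformation_step ha0 hk hK.symm hu fun v hv ↦ ?_
        exact ih a hak ha0 (-k) K ⟨-H, by linear_combination hK⟩ hv
    have hshift : ((h : ℂ) + I * u) / k = (a + I * u) / k + n := by
      rw [hn]
      push_cast
      field_simp
      ring
    rw [hred, hshift, eta_add_intCast, hn, dedekindSum_add_mul]
    have hexp : cexp (π * I * (dedekindSum a k + (H - a) / (12 * k))) =
        cexp (π * I * (dedekindSum a k + (H - (a + n * k : ℤ)) / (12 * k))) *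
          cexp (π * I * n / 12) := by
      rw [← exp_add]
      congr 1
      push_cast
      field_simp
      ring
    rw [hexp]
    push_cast
    ring

/-! ### The partition generating function -/

/-- The product for `F` at `q = exp (2 * π * I * τ)` converges to `q ^ (1 / 24) / η τ`; the limit
of the reciprocal factors exists because the product in `η` does not vanish. -/
lemma hasProd_partitionGenFun {τ : ℂ} (hτ : 0 < τ.im) :
    HasProd (fun n : ℕ ↦ 1 / (1 - cexp (2 * π * I * τ) ^ (n + 1)))
      (cexp (π * I * τ / 12) / eta τ) := by
  have hne := eta_tprod_ne_zero (z := τ) hτ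
  have h := (multipliableLocallyUniformlyOn_eta.multipliable (x := τ) hτ).hasProd.inv₀ hne
  have hval : (∏' n, (1 - eta_q n τ))⁻¹ = cexp (π * I * τ / 12) / eta τ := by
    have hq : cexp (π * I * τ / 12) = Function.Periodic.qParam 24 τ := by
      rw [Function.Periodic.qParam]
      congr 1
      push_cast
      ring
    rw [eta, hq, div_mul_eq_div_div, div_self (Function.Periodic.qParam_ne_zero τ), one_div]
  rw [← hval]
  simpa only [eta_q_eq_pow, one_div] using h

theorem theorem3p3 (h : ℤ) (k : ℕ) (H : ℤ) (hh : 1 ≤ h) (hk : h ≤ (k : ℤ))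
    (hcop : Int.gcd h (k : ℤ) = 1) (hH : h * H ≡ -1 [ZMOD (k : ℤ)])
    (z : ℂ) (hz : 0 < z.re) (w w' : ℂ)
    (hw : w = Complex.exp (2 * (Real.pi : ℂ) * Complex.I * (h : ℂ) / (k : ℂ)
      - 2 * (Real.pi : ℂ) * z / (k : ℂ) ^ 2))
    (hw' : w' = Complex.exp (2 * (Real.pi : ℂ) * Complex.I * (H : ℂ) / (k : ℂ)
      - 2 * (Real.pi : ℂ) / z)) :
    Multipliable (fun n : ℕ => 1 / (1 - w ^ (n + 1))) ∧
    Multipliable (fun n : ℕ => 1 / (1 - w' ^ (n + 1))) ∧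
    ‖w‖ < 1 ∧ ‖w'‖ < 1 ∧
    partitionGenFun w =
      Complex.exp ((Real.pi : ℂ) * Complex.I * (dedekindSum h k : ℂ))
        * (z / (k : ℂ)) ^ (1 / 2 : ℂ)
        * Complex.exp ((Real.pi : ℂ) / (12 * z) - (Real.pi : ℂ) * z / (12 * (k : ℂ) ^ 2))
        * partitionGenFun w' := by
  have hkpos : 0 < k := by omega
  have hk0 : (k : ℂ) ≠ 0 := by exact_mod_cast hkpos.ne'
  have hz0 := ne_zero_of_re_pos hz
  set u : ℂ := z / k with hu
  have hure : 0 < u.re := by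
    rw [hu, ← ofReal_natCast, div_ofReal_re]
    exact div_pos hz (by exact_mod_cast hkpos)
  have hτ := im_add_I_mul_div_pos h hkpos hure
  have hτ' := im_add_I_mul_div_pos H hkpos (re_inv_pos hure)
  rw [← div_eq_mul_inv] at hτ'
  have hτeq : ((h : ℂ) + I * u) / k = h / k + I * z / k ^ 2 := by
    rw [hu]
    field_simp
  have hτeq' : ((H : ℂ) + I / u) / k = H / k + I / z := by
    rw [hu]
    field_simp
  have hwexp : w = cexp (2 * π * I * ((h + I * u) / k)) := by
    rw [hw, hτeq]
    congr 1
    linear_combination (-2 * π * z / k ^ 2) * I_sq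
  have hwexp' : w' = cexp (2 * π * I * ((H + I / u) / k)) := by
    rw [hw', hτeq']
    congr 1
    linear_combination (-2 * π / z) * I_sq
  have hprod := hasProd_partitionGenFun hτ
  have hprod' := hasProd_partitionGenFun hτ'
  rw [← hwexp] at hprod
  rw [← hwexp'] at hprod'
  refine ⟨hprod.multipliable, hprod'.multipliable, ?_, ?_, ?_⟩
  · rw [hwexp]
    exact UpperHalfPlane.norm_exp_two_pi_I_lt_one ⟨_, hτ⟩
  · rw [hwexp']
    exact UpperHalfPlane.norm_exp_two_pi_I_lt_one ⟨_, hτ'⟩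
  · have hdvd : (k : ℤ) ∣ h * H + 1 := by
      simpa using (Int.modEq_iff_dvd.mp hH.symm)
    have hη := eta_ne_zero (z := (h + I * u) / k) hτ
    have hη' := eta_ne_zero (z := (H + I / u) / k) hτ'
    rw [partitionGenFun, partitionGenFun, hprod.tprod_eq, hprod'.tprod_eq, one_div 2, ← sqrt,
      mul_div_assoc' _ _ (eta ((H + I / u) / k)), div_eq_div_iff hη hη',
      eta_transformation hkpos h H hdvd hure]
    have hexp : cexp (π * I * ((h + I * u) / k) / 12) *
        cexp (π * I * (dedekindSum h k + (H - h) / (12 * k))) =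
        cexp (π * I * dedekindSum h k) * cexp (π / (12 * z) - π * z / (12 * k ^ 2)) *
          cexp (π * I * ((H + I / u) / k) / 12) := by
      rw [← exp_add, ← exp_add, ← exp_add, hτeq, hτeq']
      congr 1
      field_simp
      linear_combination (z ^ 2 - k ^ 2) * I_sq
    linear_combination sqrt u * eta ((h + I * u) / k) * hexp
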